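/- \textbf{Setting.} Let $\mathcal G=(\mathcal V,\mathcal E)$ be a finite simple undirected graph with neighbor sets $\mathcal N_i$, let $f\ge 0$, and let $\mathcal V=\mathcal N\cup\mathcal A$ be a partition into normal and malicious nodes which is $f$-local: $|\mathcal N_i\cap\mathcal A|\le f$ for every $i\in\mathcal N$. A node $h\neq i$ is a two-hop neighbor of $i$ if $h$ and $i$ have a common neighbor; $h$ is detectable by $i$ if $h\in\mathcal N_i$ or there are at least $2f+1$ two-hop paths from $h$ to $i$ (common neighbors of $h\ne i$). \textbf{Averaging algorithm.} Node $i$ has $y_i[0]=x_i[0]$, $z_i[0]=1$, $\mathcal A_i[0]=\emptyset$, $\lambda_i[0]=0$, $\delta_{ij}[0]=0$, $\lambda_i[1]=y_i[0]/(1+|\mathcal N_i|)$. At time $k\ge1$ it has a set $\mathcal A_i[k]$ of detected neighbors and puts $\delta_{ij}[k]=\lambda_j[k]$ (as received from $j$) for $j\in(\mathcal N_i\setminus\mathcal A_i[k])\cup\{i\}$, $\delta_{ij}[k]=0$ for the other neighbors $j$, and $$y_i[k]=\sum_{j\in\mathcal N_i\cup\{i\}}(\delta_{ij}[k]-\delta_{ij}[k-1])+|\mathcal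 A_i[k]\setminus\mathcal A_i[k-1]|\,\lambda_i[k],\qquad \lambda_i[k+1]=\lambda_i[k]+\frac{y_i[k]}{1+|\mathcal N_i\setminus\mathcal A_i[k]|}.$$ The variables $z_i,\gamma_i,\omega_{ij}$ follow the same recursion as $y_i,\lambda_i,\delta_{ij}$, started from $z_i[0]=1$. The output is $r_i[k]=y_i[k]/z_i[k]$. At time $1$ node $i$ broadcasts $(\lambda_i[1],\gamma_i[1])$; at time $k\ge 2$ it broadcasts the information set $\Phi_i[k-1]$, consisting of its ID, $\mathcal A_i[k-1]$, $(\lambda_i[k],\gamma_i[k])$ and the entries $(j,\delta_{ij}[k-1],\omega_{ij}[k-1])$, $j\in\mathcal N_i\cup\{i\}$. Each malicious node broadcasts, at each time, an arbitrary message of this format (any IDs, sets, values and entries; the same to all its neighbors) or nothing; $x_j[0]$ of a malicious node $j$ is the initial value that it adopts. \textbf{Detection algorithm.} At time $1$, $\mathcal A_i[1]$ is the set of neighbors $j$ that send nothing or whose $\gamma_j[1]$ is not $1/(1+|\mathcal N_j|)$, and $\mathcal A_i^2[1]=\emptyset$. At time $k\ge2$, node $i$ first adds to $\mathcal A_i$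 (if a neighbor) or else to $\mathcal A_i^2$ each node reported in the sets $\mathcal A_p[k-1]$ received from at least $f+1$ neighbors $p$; let $K$ be the union of the two sets so obtained. Its check value for the pair $(\lambda_h[k-1],\gamma_h[k-1])$ is $(\delta_{ih}[k-1],\omega_{ih}[k-1])$ if $h\in\mathcal N_i\cup\{i\}$, and otherwise the value on which more than half of the entries for $h$ received from the common neighbors of $h$ and $i$ agree, if there is one. Then it adds to $\mathcal A_i[k]$ each neighbor $j$ that sends nothing or whose message fails one of the following tests: (1) its reported set has the same intersection with $\mathcal N_j$ as $K$; (2) its sender ID is $j$, its reported set is contained in $\mathcal N_j$, and the IDs of its entries are those of $\mathcal N_j\cup\{j\}$; (3) its entry for each $h$ for which $i$ has a check value equals that value; (4) its $(\lambda_j[k],\gamma_j[k])$ is the pair that the averaging formula yields from its present and its previous information set. \textbf{Misbehavior.} A malicious node misbehaves at time $1$ if it sends nothing or $\gamma_j[1]\neq 1/(1+|\mathcal N_j|)$, and at time $k\ge2$ if its broadcast is not the $\Phi_j[k-1]$ that the averaging algorithm prescribes when it is run on the actual broadcasts of the neighbors of $j$, with $\mathcal A_j[t]$, for every $t\le k-1$,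 the exact set of malicious neighbors of $j$ that have misbehaved by time $t$. Let $\mathcal N_0$ consist of the normal nodes and the malicious nodes that never misbehave. \textbf{Theorem.} (a) The following are equivalent: (i) for all initial values, all $f$-local sets $\mathcal A$ and all behaviors of the malicious nodes, each normal node $i$ detects every misbehaving malicious node $j$ within two hops, that is, if $j$ misbehaves at time $k$, then $j\in\mathcal A_i[k]$ if $j$ is a neighbor of $i$, and $j\in\mathcal A_i[k+1]\cup\mathcal A_i^2[k+1]$ if $j$ is a two-hop neighbor of $i$; (ii) for every node $i\in\mathcal V$, every two-hop neighbor $h$ of $i$ is detectable by $i$. (b) If (ii) holds and $\mathcal G$ is connected, then resilient average consensus is achieved: for all initial values, all $f$-local sets $\mathcal A$ and all behaviors of the malicious nodes, for every normal node $i$, $z_i[k]\neq0$ for all large $k$ and $$\lim_{k\to\infty}r_i[k]=\frac{1}{|\mathcal N_0|}\sum_{j\in\mathcal N_0}x_j[0].$$ -/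

import Mathlib

open Filter Topology

noncomputable section

namespace ResilientConsensus

/-! ### Graph notions -/

section Graph

variable {V : Type*} [Fintype V]

open Classical in
/-- The set of neighbors of node `i`. -/
def nbrs (G : SimpleGraph V) (i : V) : Finset V := Finset.univ.filter fun j => G.Adj j i

open Classical in
/-- The intermediate nodes `p` of the two-hop paths `(h, p, i)` (used for `h ≠ i`). -/
def middleNodes (G : SimpleGraph V) (h i : V) : Finset V :=
  Finset.univ.filter fun p => G.Adj h p ∧ G.Adj p i

/-- `h` is a two-hop neighbor of `i`: there is a path `(h, p, i)` of distinct nodes. -/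
def IsTwoHopNeighbor (G : SimpleGraph V) (h i : V) : Prop :=
  h ≠ i ∧ ∃ p, G.Adj h p ∧ G.Adj p i

/-- `h` is detectable by `i`: `h` is a neighbor of `i`, or there are at least `2 f + 1` two-hop
paths from `h` to `i`. -/
def Detectable (G : SimpleGraph V) (f : ℕ) (h i : V) : Prop :=
  G.Adj h i ∨ (h ≠ i ∧ 2 * f + 1 ≤ (middleNodes G h i).card)

/-- The graph condition: every two-hop neighbor of every node is detectable by that node. -/
def TwoHopDetectable (G : SimpleGraph V) (f : ℕ) : Prop :=
  ∀ i h : V, IsTwoHopNeighbor G h i → Detectable G f h i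

open Classical in
/-- The set `A` of malicious nodes is `f`-local: every normal node has at most `f` neighbors
in `A`. -/
def IsLocal (G : SimpleGraph V) (f : ℕ) (A : Finset V) : Prop :=
  ∀ i, i ∉ A → (nbrs G i ∩ A).card ≤ f

end Graph

/-! ### Messages and states

The `y`- and the `z`-quantities undergo the same linear operations; they are kept as a pair in
`ℝ × ℝ`, the first component for `y, λ, δ` and the second one for `z, γ, ω`. -/

/-- An information set `Φ_i[k]`, broadcast at time `k + 1`. -/
@[ext] structure InfoSet (V : Type*) where
  /-- the ID under which the set is sent -/
  sender : V
  /-- the set `𝒜_i[k]` of nodes detected by the sender by time `k` -/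
  accused : Finset V
  /-- the running sums `(δ_ii[k+1|k], ω_ii[k+1|k])` of the sender -/
  next : ℝ × ℝ
  /-- the entries `(j, δ_ij[k|k], ω_ij[k|k])`; `none` when the set has no entry with ID `j` -/
  entries : V → Option (ℝ × ℝ)

/-- The variables of the averaging algorithm at node `i` at time `k`. -/
structure AvgState (V : Type*) where
  /-- `𝒜_i[k]` -/
  accused : Finset V
  /-- `(δ_ij[k], ω_ij[k])` -/
  delta : V → ℝ × ℝ
  /-- `(y_i[k], z_i[k])` -/
  mass : ℝ × ℝ
  /-- `(λ_i[k+1], γ_i[k+1])` -/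
  next : ℝ × ℝ

/-- The whole state of node `i` at time `k` when it runs the averaging algorithm together with the
fully distributed detection algorithm. -/
structure NodeState (V : Type*) extends AvgState V where
  /-- the local set `𝒜_i²[k]` of detected nodes which are not neighbors -/
  accused2 : Finset V
  /-- the last information set that was received from each neighbor -/
  heard : V → InfoSet V

/-- The choices of the adversary. As all the sequences of broadcasts are allowed, this covers
omniscient, cooperating and adaptive malicious nodes. -/
structure Attack (V : Type*) where
  /-- the set of malicious nodes -/
  malicious : Finset V
  /-- the value with which a malicious node starts in place of `z_j[0] = 1`; `none` when it makes no
  initial transmission -/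
  initialZ : V → Option ℝ
  /-- what a malicious node broadcasts in place of `Φ_j[k]`, `k ≥ 1`; `none` when it does not
  transmit -/
  info : ℕ → V → Option (InfoSet V)

section Algorithm

variable {V : Type*} [Fintype V]

/-! ### The averaging algorithm -/

/-- `1 / (1 + d_i)`, where `d_i` counts the neighbors of `i` that are not in `a`. -/
def weight (G : SimpleGraph V) (i : V) (a : Finset V) : ℝ :=
  open Classical in 1 / (1 + ((nbrs G i \ a).card : ℝ))

open Classical in
/-- `(y_i[k], z_i[k])`, from `δ = δ_i[k-1]`, `δ' = δ_i[k]`, `a = 𝒜_i[k-1]`, `a' = 𝒜_i[k]` and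
`l = λ_i[k]`: the differences of the incoming running sums, plus the compensation for the newly
detected neighbors. -/
def newMass (G : SimpleGraph V) (i : V) (δ δ' : V → ℝ × ℝ) (a a' : Finset V) (l : ℝ × ℝ) : ℝ × ℝ :=
  ∑ j ∈ insert i (nbrs G i), (δ' j - δ j)
    + (((nbrs G i \ a) \ (nbrs G i \ a')).card : ℝ) • l

/-- The state at time `0`: `y_i[0] = x_i[0]`, `z_i[0] = 1`, nothing received and nobody detected;
`λ_i[1]` and `γ_i[1]` are ready to be sent. -/
def initAvg (G : SimpleGraph V) (x : V → ℝ) (i : V) : AvgState V where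
  accused := ∅
  delta := fun _ => 0
  mass := (x i, 1)
  next := weight G i ∅ • (x i, 1)

open Classical in
/-- One step of the averaging at node `i`, where `a'` is the new set of detected nodes and `recv j`
is the pair `(λ_j[k], γ_j[k])` received from `j`. -/
def avgStep (G : SimpleGraph V) (i : V) (s : AvgState V) (a' : Finset V) (recv : V → ℝ × ℝ) :
    AvgState V :=
  let δ' : V → ℝ × ℝ := fun j =>
    if j = i then s.next else if j ∈ nbrs G i \ a' then recv j else 0
  let y := newMass G i s.delta δ' s.accused a' s.next
  { accused := a'
    delta := δ'
    mass := y
    next := s.next + weight G i a' • y }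

open Classical in
/-- The information set `Φ_i[k]` prescribed by the state of node `i` at time `k`. -/
def infoSet (G : SimpleGraph V) (i : V) (s : AvgState V) : InfoSet V where
  sender := i
  accused := s.accused
  next := s.next
  entries := fun h => if h ∈ insert i (nbrs G i) then some (s.delta h) else none

/-! ### The fully distributed detection algorithm

In the definitions below `s` is the state of node `i` at time `k - 1` and `msg j` is the broadcast
of node `j` at time `k`, in place of `Φ_j[k-1]`. Node `i` only looks at `msg j` for its
neighbors `j`. -/

open Classical in
/-- Node `i` accepts that `a` is malicious: at least `f + 1` of its neighbors say so. -/
def Voted (G : SimpleGraph V) (f : ℕ) (i : V) (msg : V → Option (InfoSet V)) (a : V) : Prop :=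
  f + 1 ≤ ((nbrs G i).filter fun p => ∃ m, msg p = some m ∧ a ∈ m.accused).card

open Classical in
/-- `v` is the value which node `i` holds in its check set for `(δ_hh[k-1], ω_hh[k-1])`: its own
record when `h` is `i` or a neighbor of `i`, and otherwise the value that more than half of the
values received from the common neighbors of `h` and `i` agree on, if there is one. -/
def CheckValue (G : SimpleGraph V) (i : V) (s : NodeState V) (msg : V → Option (InfoSet V))
    (h : V) (v : ℝ × ℝ) : Prop :=
  if h ∈ insert i (nbrs G i) then v = s.delta h
  else
    ((middleNodes G h i).filter fun p => ((msg p).bind fun m => m.entries h).isSome).card <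
      2 * ((middleNodes G h i).filter fun p =>
        ((msg p).bind fun m => m.entries h) = some v).card

/-- The entry of `m` with ID `h`, as a number. -/
def entryValue (m : InfoSet V) (h : V) : ℝ × ℝ := (m.entries h).getD 0

/-- The running sums which node `j` has to announce in `m` (in place of `Φ_j[k-1]`), reconstructed
from `m` and from its previous information set `m₀`. -/
def reconstruct (G : SimpleGraph V) (j : V) (m₀ m : InfoSet V) : ℝ × ℝ :=
  entryValue m j + weight G j m.accused •
    newMass G j (entryValue m₀) (entryValue m) m₀.accused m.accused (entryValue m j)

open Classical in
/-- The information set `m` received from the neighbor `j` passes the four tests of node `i`, where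
`known` is the set of all the nodes that node `i` holds as detected after the majority voting. -/
def Passes (G : SimpleGraph V) (i : V) (s : NodeState V) (msg : V → Option (InfoSet V))
    (known : Finset V) (j : V) (m : InfoSet V) : Prop :=
  -- Step 1: the detection information of `j` on its neighbors agrees with that of `i` (so faulty
  -- reporters of a node in `known` are caught here)
  (nbrs G j ∩ m.accused = nbrs G j ∩ known) ∧
  -- Step 2: the IDs are those that `j` has to use
  (m.sender = j ∧ m.accused ⊆ nbrs G j ∧
    ∀ h, (m.entries h).isSome ↔ h ∈ insert j (nbrs G j)) ∧
  -- Step 3: the past values agree with the check set of `i`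
  (∀ h ∈ insert j (nbrs G j), ∀ v, CheckValue G i s msg h v → m.entries h = some v) ∧
  -- Step 4: the announced running sums follow the averaging
  m.next = reconstruct G j (s.heard j) m

open Classical in
/-- `𝒜_i[k]` after the majority voting and before the tests. -/
def votedAccused (G : SimpleGraph V) (f : ℕ) (i : V) (s : NodeState V)
    (msg : V → Option (InfoSet V)) : Finset V :=
  s.accused ∪ (nbrs G i).filter fun a => Voted G f i msg a

open Classical in
/-- `𝒜_i²[k]`. -/
def newAccused2 (G : SimpleGraph V) (f : ℕ) (i : V) (s : NodeState V)
    (msg : V → Option (InfoSet V)) : Finset V :=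
  s.accused2 ∪ Finset.univ.filter fun a => a ∉ nbrs G i ∧ Voted G f i msg a

open Classical in
/-- `𝒜_i[k]`: the neighbors that do not transmit or fail a test are added. -/
def newAccused (G : SimpleGraph V) (f : ℕ) (i : V) (s : NodeState V)
    (msg : V → Option (InfoSet V)) : Finset V :=
  let pre := votedAccused G f i s msg
  pre ∪ (nbrs G i).filter fun j =>
    ¬ ∃ m, msg j = some m ∧ Passes G i s msg (pre ∪ newAccused2 G f i s msg) j m

/-- The step of node `i` at a time `k ≥ 2`. -/
def nodeStep (G : SimpleGraph V) (f : ℕ) (i : V) (s : NodeState V)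
    (msg : V → Option (InfoSet V)) : NodeState V where
  toAvgState := avgStep G i s.toAvgState (newAccused G f i s msg)
    fun j => ((msg j).map InfoSet.next).getD 0
  accused2 := newAccused2 G f i s msg
  heard := fun j => (msg j).getD (s.heard j)

/-! ### The execution -/

open Classical in
/-- The initial broadcast `(λ_j[1], γ_j[1])` of node `j` at time `1`. For a malicious node, `x j` is
the initial value that it adopts. -/
def firstMsg (G : SimpleGraph V) (x : V → ℝ) (att : Attack V) (j : V) : Option (ℝ × ℝ) :=
  if j ∈ att.malicious then (att.initialZ j).map fun z => weight G j ∅ • (x j, z)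
  else some (initAvg G x j).next

/-- Node `j` sends initial values: something is sent, and `γ_j[1]` comes from `z_j[0] = 1`. -/
def ValidFirst (G : SimpleGraph V) (x : V → ℝ) (att : Attack V) (j : V) : Prop :=
  ∃ v, firstMsg G x att j = some v ∧ v.2 = weight G j ∅

open Classical in
/-- The state of node `i` at time `1`: the neighbors that do not send initial values are detected. The
information set of time `0` (nothing received, nobody detected) is common knowledge; of it only
these zero entries and this empty set are ever used. -/
def firstState (G : SimpleGraph V) (x : V → ℝ) (att : Attack V) (i : V) : NodeState V where
  toAvgState := avgStep G i (initAvg G x i) ((nbrs G i).filter fun j => ¬ ValidFirst G x att j)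
    fun j => (firstMsg G x att j).getD 0
  accused2 := ∅
  heard := fun j => infoSet G j (initAvg G x j)

open Classical in
/-- The broadcasts in place of `Φ_j[k]`: normal nodes (in state `s j`) follow the algorithm. -/
def broadcast (G : SimpleGraph V) (att : Attack V) (k : ℕ) (s : V → NodeState V) (j : V) :
    Option (InfoSet V) :=
  if j ∈ att.malicious then att.info k j else some (infoSet G j (s j).toAvgState)

/-- `state G f x att k i` is the state of node `i` at time `k + 1`. (For malicious nodes it has no
influence on the other nodes.) -/
def state (G : SimpleGraph V) (f : ℕ) (x : V → ℝ) (att : Attack V) : ℕ → V → NodeState V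
  | 0 => fun i => firstState G x att i
  | k + 1 => fun i =>
      nodeStep G f i (state G f x att k i) (broadcast G att (k + 1) (state G f x att k))

/-- `sent G f x att k j` is the broadcast of node `j` at time `k + 2`, in place of `Φ_j[k+1]`. -/
def sent (G : SimpleGraph V) (f : ℕ) (x : V → ℝ) (att : Attack V) (k : ℕ) :
    V → Option (InfoSet V) :=
  broadcast G att (k + 1) (state G f x att k)

/-! ### Misbehavior -/

open Classical in
/-- `reference G f x att k` refers to time `k + 1`. Its first component is the set of malicious nodes
that have behaved against the averaging by then, i.e. for which some broadcast up to that time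
was not the one prescribed by the averaging algorithm. Its second component holds, for each node, the
variables prescribed by the averaging algorithm, run on the actual broadcasts of the neighbors and
with the exact set of the neighbors that have misbehaved. -/
def reference (G : SimpleGraph V) (f : ℕ) (x : V → ℝ) (att : Attack V) :
    ℕ → Finset V × (V → AvgState V)
  | 0 =>
      let F := att.malicious.filter fun j => ¬ ValidFirst G x att j
      (F, fun j => avgStep G j (initAvg G x j) (nbrs G j ∩ F)
        fun h => (firstMsg G x att h).getD 0)
  | k + 1 =>
      let R := reference G f x att k
      let F := R.1 ∪ att.malicious.filter fun j =>
        sent G f x att k j ≠ some (infoSet G j (R.2 j))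
      (F, fun j => avgStep G j (R.2 j) (nbrs G j ∩ F)
        fun h => ((sent G f x att k h).map InfoSet.next).getD 0)

/-- The malicious nodes that have misbehaved in some broadcast up to time `k + 1`. -/
def misbehaved (G : SimpleGraph V) (f : ℕ) (x : V → ℝ) (att : Attack V) (k : ℕ) : Finset V :=
  (reference G f x att k).1

open Classical in
/-- The set `𝒩₀` of the nodes that behave properly at all times: the normal nodes and the malicious
nodes that never misbehave. -/
def proper (G : SimpleGraph V) (f : ℕ) (x : V → ℝ) (att : Attack V) : Finset V :=
  Finset.univ.filter fun j => ∀ k, j ∉ misbehaved G f x att k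

/-! ### The two properties -/

/-- Whatever the `f`-local malicious nodes do, each normal node detects all malicious neighbors within
two hops that misbehave: a neighbor at the time of the faulty broadcast, a two-hop neighbor
at the next time. -/
def DetectsWithinTwoHops (G : SimpleGraph V) (f : ℕ) : Prop :=
  ∀ (x : V → ℝ) (att : Attack V), IsLocal G f att.malicious →
    ∀ i, i ∉ att.malicious → ∀ (k : ℕ), ∀ j ∈ misbehaved G f x att k,
      (G.Adj j i → j ∈ (state G f x att k i).accused) ∧
      (IsTwoHopNeighbor G j i →
        j ∈ (state G f x att (k + 1) i).accused ∨ j ∈ (state G f x att (k + 1) i).accused2)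

/-- Resilient average consensus: whatever the `f`-local malicious nodes do, the output
`r_i[k] = y_i[k] / z_i[k]` of each normal node is eventually well defined and converges to the
average of the initial values of the nodes in `𝒩₀`. -/
def ResilientAverageConsensus (G : SimpleGraph V) (f : ℕ) : Prop :=
  ∀ (x : V → ℝ) (att : Attack V), IsLocal G f att.malicious →
    ∀ i, i ∉ att.malicious →
      (∀ᶠ k in atTop, (state G f x att k i).mass.2 ≠ 0) ∧
      Tendsto (fun k => (state G f x att k i).mass.1 / (state G f x att k i).mass.2) atTop
        (𝓝 ((∑ j ∈ proper G f x att, x j) / ((proper G f x att).card : ℝ)))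

end Algorithm

end ResilientConsensus

end

/-! A normal node `i` sees the neighborhood of each neighbor `j` indirectly. If every two-hop neighbor
`h` of `i` that is not adjacent has at least `2 f + 1` common neighbors with `i`, then at least `f + 1`
of them are normal and at most `f` malicious. So `i` learns, with a delay of one step, exactly which
nodes within two hops have misbehaved, and holds the true value of each of them by majority
(`Synchronized.checkValue_iff`). The four tests then accept the prescribed message of `j` and no other
one (`Synchronized.passes_iff`), and by induction on time the detected neighbors of a normal node are
exactly the misbehaving ones and its variables are those of the reference execution
(`Synchronized.succ`). Conversely, if `h` and `i` are not adjacent and have at most `2 f` common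
neighbors, then half of these, rounded up, can give the same false record of the normal node `h` and
adapt their running sums to it: no majority speaks against them, and `i` accepts (`passes_forgery`).

For the consensus, the running sums of the nodes outside of the misbehaving set `F` satisfy
`d_i λ_i[k+1] = x_i + ∑ λ_j[k]`, with `j` in the closed neighborhood of `i` without `F` and `d_i` the size
of that neighborhood; the compensation for detected neighbors is what keeps this true while `F` grows
(`balance_avgStep`). Once `F` is constant, the increments `u_i[k] = λ_i[k+1] - λ_i[k] = y_i[k] / d_i`
are averaged over the closed neighborhoods, and `∑ d_i u_i = ∑ x_i` is conserved. The energy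
`∑ d_i u_i²` decreases by the sum of the squared deviations `(u_j[k] - u_i[k+1])²` (`energy_decay`);
these tend to `0`, so on a connected graph all `u_i` tend to `∑ x_j / ∑ d_j`
(`tendsto_increment_of_runningSum`). The same holds for `z` with all `x_j` replaced by `1`, and the
quotient of the limits is the average. The nodes outside of `F` do form a connected graph, as a
malicious node on a walk can be replaced by a normal common neighbor (`exists_normal_reachable`). -/

noncomputable section

namespace ResilientConsensus

open scoped Classical

variable {V : Type*} [Fintype V] {G : SimpleGraph V} {f : ℕ} {x : V → ℝ} {att : Attack V}

/-! ### Elementary facts on neighbors and weights -/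

@[simp] lemma mem_nbrs {i j : V} : j ∈ nbrs G i ↔ G.Adj j i := by
  simp [nbrs]

@[simp] lemma mem_middleNodes {h i p : V} : p ∈ middleNodes G h i ↔ G.Adj h p ∧ G.Adj p i := by
  simp [middleNodes]

lemma weight_pos (G : SimpleGraph V) (i : V) (a : Finset V) : 0 < weight G i a := by
  unfold weight; positivity

/-! ### The reference execution -/

/-- The pair `(λ_h[k+1], γ_h[k+1])` that the neighbors of `h` receive at time `k + 1`. -/
def received (G : SimpleGraph V) (f : ℕ) (x : V → ℝ) (att : Attack V) : ℕ → V → ℝ × ℝ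
  | 0 => fun h => (firstMsg G x att h).getD 0
  | k + 1 => fun h => ((sent G f x att k h).map InfoSet.next).getD 0

/-- The variables prescribed at time `k`, one time step before those of `reference G f x att k`. -/
def prescribedBefore (G : SimpleGraph V) (f : ℕ) (x : V → ℝ) (att : Attack V) :
    ℕ → V → AvgState V
  | 0 => fun j => initAvg G x j
  | k + 1 => fun j => (reference G f x att k).2 j

/-- The variables prescribed at time `k + 1`. -/
def prescribed (G : SimpleGraph V) (f : ℕ) (x : V → ℝ) (att : Attack V) (k : ℕ) (j : V) :
    AvgState V :=
  (reference G f x att k).2 j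

lemma prescribed_eq (k : ℕ) (j : V) :
    prescribed G f x att k j = avgStep G j (prescribedBefore G f x att k j)
      (nbrs G j ∩ misbehaved G f x att k) (received G f x att k) := by
  cases k <;> rfl

lemma misbehaved_zero :
    misbehaved G f x att 0 = att.malicious.filter fun j => ¬ ValidFirst G x att j := rfl

lemma misbehaved_succ (k : ℕ) :
    misbehaved G f x att (k + 1) = misbehaved G f x att k ∪ att.malicious.filter fun j =>
      sent G f x att k j ≠ some (infoSet G j (prescribed G f x att k j)) := rfl

lemma misbehaved_subset_malicious (k : ℕ) : misbehaved G f x att k ⊆ att.malicious := by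
  induction k with
  | zero => exact Finset.filter_subset _ _
  | succ k ih =>
    rw [misbehaved_succ]
    exact Finset.union_subset ih (Finset.filter_subset _ _)

lemma misbehaved_monotone : Monotone (misbehaved G f x att) :=
  monotone_nat_of_le_succ fun k => by
    rw [misbehaved_succ]; exact Finset.subset_union_left

/-- The record which every node that follows the averaging has at time `k + 1` of `h`, be it a
neighbor or the node itself. -/
def commonValue (G : SimpleGraph V) (f : ℕ) (x : V → ℝ) (att : Attack V) (k : ℕ) (h : V) : ℝ × ℝ :=
  if h ∈ misbehaved G f x att k then 0 else received G f x att k h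

lemma firstMsg_of_validFirst {j : V} (h : ValidFirst G x att j) :
    firstMsg G x att j = some (initAvg G x j).next := by
  obtain ⟨v, hv, hw⟩ := h
  unfold firstMsg at hv ⊢
  split_ifs at hv ⊢ with hj
  · obtain ⟨z, hz, rfl⟩ := Option.map_eq_some_iff.1 hv
    have hz1 : z = 1 := by
      have := weight_pos G j ∅
      simp only [Prod.smul_mk, smul_eq_mul] at hw
      exact mul_left_cancel₀ this.ne' (by linarith)
    simp [hz, hz1, initAvg]
  · rfl

lemma validFirst_of_not_mem {j : V} (hj : j ∉ att.malicious) : ValidFirst G x att j :=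
  ⟨(initAvg G x j).next, by simp [firstMsg, hj], by simp [initAvg]⟩

lemma validFirst_iff {j : V} : ValidFirst G x att j ↔ j ∉ misbehaved G f x att 0 := by
  rw [misbehaved_zero, Finset.mem_filter]
  by_cases hj : j ∈ att.malicious
  · simp [hj]
  · simp [hj, validFirst_of_not_mem hj]

/-! ### Detection is exact on detectable graphs -/

/-- The invariant of the execution at time `k + 1`: normal nodes have exactly the variables
prescribed by the averaging, nodes that have not misbehaved send what is prescribed, and this is
what their normal neighbors remember; no node is held as detected unless it has misbehaved. -/
structure Synchronized (G : SimpleGraph V) (f : ℕ) (x : V → ℝ) (att : Attack V) (k : ℕ) :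
    Prop where
  state_eq : ∀ i ∉ att.malicious, (state G f x att k i).toAvgState = prescribed G f x att k i
  received_eq : ∀ j ∉ misbehaved G f x att k,
    received G f x att k j = (prescribedBefore G f x att k j).next
  heard_eq : ∀ i ∉ att.malicious, ∀ j ∉ misbehaved G f x att k,
    (state G f x att k i).heard j = infoSet G j (prescribedBefore G f x att k j)
  accused2_subset : ∀ i ∉ att.malicious,
    (state G f x att k i).accused2 ⊆ misbehaved G f x att k

/-- At time `1`, the variables of every node are the prescribed ones. -/
lemma firstState_toAvgState (i : V) :
    (state G f x att 0 i).toAvgState = prescribed G f x att 0 i := by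
  have : ((nbrs G i).filter fun j => ¬ ValidFirst G x att j)
      = nbrs G i ∩ misbehaved G f x att 0 := by
    ext j
    rw [Finset.mem_filter, Finset.mem_inter, validFirst_iff (f := f), not_not]
  rw [prescribed_eq, ← this]
  rfl

lemma synchronized_zero : Synchronized G f x att 0 where
  state_eq := fun i _ => firstState_toAvgState i
  received_eq := fun j hj => by
    simp [received, firstMsg_of_validFirst (validFirst_iff.2 hj), prescribedBefore]
  heard_eq := fun i _ j _ => rfl
  accused2_subset := fun i _ => Finset.empty_subset _

lemma prescribed_accused (k : ℕ) (j : V) :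
    (prescribed G f x att k j).accused = nbrs G j ∩ misbehaved G f x att k := by
  rw [prescribed_eq]; rfl

section Step

variable {k : ℕ} {i j : V}

lemma prescribed_delta
    (hr : ∀ j ∉ misbehaved G f x att k,
      received G f x att k j = (prescribedBefore G f x att k j).next)
    (hj : j ∉ misbehaved G f x att k) {h : V} (hh : h ∈ insert j (nbrs G j)) :
    (prescribed G f x att k j).delta h = commonValue G f x att k h := by
  rw [prescribed_eq]
  simp only [avgStep, commonValue]
  rcases eq_or_ne h j with rfl | hne
  · simp [hj, hr h hj]
  · rw [Finset.mem_insert] at hh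
    have hh' := hh.resolve_left hne
    by_cases hm : h ∈ misbehaved G f x att k <;> simp [hne, hm, hh']

lemma Synchronized.sent_of_normal (hs : Synchronized G f x att k) (hi : i ∉ att.malicious) :
    sent G f x att k i = some (infoSet G i (prescribed G f x att k i)) := by
  simp [sent, broadcast, hi, hs.state_eq i hi]

lemma Synchronized.sent_of_not_mem (hs : Synchronized G f x att k)
    (hj : j ∉ misbehaved G f x att (k + 1)) :
    sent G f x att k j = some (infoSet G j (prescribed G f x att k j)) := by
  by_cases hm : j ∈ att.malicious
  · rw [misbehaved_succ, Finset.mem_union, Finset.mem_filter] at hj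
    by_contra h
    exact hj (Or.inr ⟨hm, h⟩)
  · exact hs.sent_of_normal hm

/-- `f + 1` votes contain one of a normal neighbor, so that only misbehaving nodes are voted
down. -/
lemma Synchronized.mem_misbehaved_of_voted (hs : Synchronized G f x att k)
    (hA : IsLocal G f att.malicious) (hi : i ∉ att.malicious) {a : V}
    (ha : Voted G f i (sent G f x att k) a) : a ∈ misbehaved G f x att k := by
  by_contra hna
  have hsub : ((nbrs G i).filter fun p => ∃ m, sent G f x att k p = some m ∧ a ∈ m.accused) ⊆
      nbrs G i ∩ att.malicious := by
    intro p hp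
    obtain ⟨hpi, m, hm, ham⟩ := Finset.mem_filter.1 hp
    refine Finset.mem_inter.2 ⟨hpi, ?_⟩
    by_contra hpA
    rw [hs.sent_of_normal hpA, Option.some_inj] at hm
    subst hm
    rw [infoSet, prescribed_accused] at ham
    exact hna (Finset.mem_inter.1 ham).2
  have h1 := Finset.card_le_card hsub
  have h2 := hA i hi
  unfold Voted at ha
  omega

lemma card_middleNodes_malicious_le (hA : IsLocal G f att.malicious) (hi : i ∉ att.malicious)
    (h : V) : ((middleNodes G h i).filter (· ∈ att.malicious)).card ≤ f := by
  refine (Finset.card_le_card ?_).trans (hA i hi)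
  intro p hp
  simp only [Finset.mem_filter, mem_middleNodes, Finset.mem_inter, mem_nbrs] at hp ⊢
  exact ⟨hp.1.2, hp.2⟩

lemma lt_card_middleNodes_normal (hA : IsLocal G f att.malicious) (hi : i ∉ att.malicious)
    {h : V} (hc : 2 * f + 1 ≤ (middleNodes G h i).card) :
    f + 1 ≤ ((middleNodes G h i).filter (· ∉ att.malicious)).card := by
  have h1 := card_middleNodes_malicious_le hA hi h
  have h2 := Finset.card_filter_add_card_filter_not (s := middleNodes G h i) (· ∈ att.malicious)
  omega

lemma TwoHopDetectable.le_card (hG : TwoHopDetectable G f) {h : V} (ht : IsTwoHopNeighbor G h i)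
    (hn : ¬ G.Adj h i) : 2 * f + 1 ≤ (middleNodes G h i).card :=
  ((hG i h ht).resolve_left hn).2

/-- A misbehaving two-hop neighbor is reported by at least `f + 1` normal common neighbors. -/
lemma Synchronized.voted_of_twoHop (hs : Synchronized G f x att k)
    (hA : IsLocal G f att.malicious) (hG : TwoHopDetectable G f) (hi : i ∉ att.malicious) {a : V}
    (ha : a ∈ misbehaved G f x att k) (ht : IsTwoHopNeighbor G a i) (hn : ¬ G.Adj a i) :
    Voted G f i (sent G f x att k) a := by
  refine (lt_card_middleNodes_normal hA hi (hG.le_card ht hn)).trans (Finset.card_le_card ?_)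
  intro p hp
  simp only [Finset.mem_filter, mem_middleNodes, mem_nbrs] at hp ⊢
  refine ⟨hp.1.2, _, hs.sent_of_normal hp.2, ?_⟩
  rw [infoSet, prescribed_accused]
  exact Finset.mem_inter.2 ⟨mem_nbrs.2 hp.1.1, ha⟩

lemma Synchronized.accused_eq (hs : Synchronized G f x att k) (hi : i ∉ att.malicious) :
    (state G f x att k i).accused = nbrs G i ∩ misbehaved G f x att k := by
  rw [hs.state_eq i hi, prescribed_accused]

lemma Synchronized.votedAccused_eq (hs : Synchronized G f x att k)
    (hA : IsLocal G f att.malicious) (hi : i ∉ att.malicious) :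
    votedAccused G f i (state G f x att k i) (sent G f x att k)
      = nbrs G i ∩ misbehaved G f x att k := by
  unfold votedAccused
  rw [hs.accused_eq hi, Finset.union_eq_left]
  intro a ha
  rw [Finset.mem_filter] at ha
  exact Finset.mem_inter.2 ⟨ha.1, hs.mem_misbehaved_of_voted hA hi ha.2⟩

lemma Synchronized.newAccused2_subset (hs : Synchronized G f x att k)
    (hA : IsLocal G f att.malicious) (hi : i ∉ att.malicious) :
    newAccused2 G f i (state G f x att k i) (sent G f x att k) ⊆ misbehaved G f x att k := by
  refine Finset.union_subset (hs.accused2_subset i hi) fun a ha => ?_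
  exact hs.mem_misbehaved_of_voted hA hi (Finset.mem_filter.1 ha).2.2

/-- After the majority voting, a normal node knows all misbehaving nodes within two hops. -/
lemma Synchronized.nbrs_inter_known (hs : Synchronized G f x att k)
    (hA : IsLocal G f att.malicious) (hG : TwoHopDetectable G f) (hi : i ∉ att.malicious)
    (hji : G.Adj j i) :
    nbrs G j ∩ (votedAccused G f i (state G f x att k i) (sent G f x att k) ∪
      newAccused2 G f i (state G f x att k i) (sent G f x att k))
      = nbrs G j ∩ misbehaved G f x att k := by
  rw [hs.votedAccused_eq hA hi]
  refine Finset.Subset.antisymm (Finset.inter_subset_inter_left (Finset.union_subset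
    Finset.inter_subset_right (hs.newAccused2_subset hA hi))) fun a ha => ?_
  obtain ⟨haj, ham⟩ := Finset.mem_inter.1 ha
  refine Finset.mem_inter.2 ⟨haj, Finset.mem_union.2 ?_⟩
  by_cases hai : G.Adj a i
  · exact Or.inl (Finset.mem_inter.2 ⟨mem_nbrs.2 hai, ham⟩)
  · have hne : a ≠ i := fun h => hi (h ▸ misbehaved_subset_malicious k ham)
    refine Or.inr (Finset.mem_union_right _ (Finset.mem_filter.2 ⟨Finset.mem_univ _, ?_,
      hs.voted_of_twoHop hA hG hi ham ⟨hne, j, mem_nbrs.1 haj, hji⟩ hai⟩))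
    rwa [mem_nbrs]

/-- The check set of a normal node holds exactly the common values of the nodes within two hops: the
value of a two-hop neighbor is confirmed by at least `f + 1` of the common neighbors, and disputed
by at most `f`. -/
lemma Synchronized.checkValue_iff (hs : Synchronized G f x att k)
    (hA : IsLocal G f att.malicious) (hG : TwoHopDetectable G f) (hi : i ∉ att.malicious)
    (hji : G.Adj j i) {h : V} (hh : h ∈ insert j (nbrs G j)) (v : ℝ × ℝ) :
    CheckValue G i (state G f x att k i) (sent G f x att k) h v
      ↔ v = commonValue G f x att k h := by
  have hnot : ∀ p, p ∉ att.malicious → p ∉ misbehaved G f x att k :=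
    fun p hp hp' => hp (misbehaved_subset_malicious k hp')
  unfold CheckValue
  split_ifs with hhi
  · rw [hs.state_eq i hi, prescribed_delta hs.received_eq (hnot i hi) hhi]
  · rw [Finset.mem_insert, not_or, mem_nbrs] at hhi
    have hhj : G.Adj h j := by
      rcases Finset.mem_insert.1 hh with rfl | hh
      · exact absurd hji hhi.2
      · exact mem_nbrs.1 hh
    have hc := hG.le_card ⟨hhi.1, j, hhj, hji⟩ hhi.2
    have hbad := card_middleNodes_malicious_le hA hi h
    have hgood := lt_card_middleNodes_normal hA hi hc
    set M := middleNodes G h i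
    set e : V → Option (ℝ × ℝ) := fun p => (sent G f x att k p).bind fun m => m.entries h
    have hval : ∀ p ∈ M, p ∉ att.malicious → e p = some (commonValue G f x att k h) := by
      intro p hp hpA
      have hhp : h ∈ insert p (nbrs G p) :=
        Finset.mem_insert_of_mem (mem_nbrs.2 (mem_middleNodes.1 hp).1)
      simp only [e, hs.sent_of_normal hpA, Option.bind_some, infoSet, hhp, if_true,
        prescribed_delta hs.received_eq (hnot p hpA) hhp]
    change (M.filter fun p => (e p).isSome).card < 2 * (M.filter fun p => e p = some v).card ↔ _
    constructor
    · intro hlt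
      by_contra hv
      -- the supporters of another value are malicious, and outnumbered by the normal nodes
      have h1 : (M.filter fun p => e p = some v) ⊆ M.filter (· ∈ att.malicious) := by
        intro p hp
        rw [Finset.mem_filter] at hp ⊢
        refine ⟨hp.1, by_contra fun hpA => hv ?_⟩
        rw [hval p hp.1 hpA, Option.some_inj] at hp
        exact hp.2.symm
      have h2 : (M.filter fun p => e p = some v) ∪ M.filter (· ∉ att.malicious) ⊆
          M.filter fun p => (e p).isSome := by
        intro p hp
        rw [Finset.mem_union, Finset.mem_filter, Finset.mem_filter] at hp
        rw [Finset.mem_filter]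
        rcases hp with hp | hp
        · exact ⟨hp.1, by simp [hp.2]⟩
        · exact ⟨hp.1, by simp [hval p hp.1 hp.2]⟩
      have hd : Disjoint (M.filter fun p => e p = some v) (M.filter (· ∉ att.malicious)) := by
        rw [Finset.disjoint_left]
        intro p hp hp'
        exact (Finset.mem_filter.1 hp').2 (Finset.mem_filter.1 (h1 hp)).2
      have h3 := Finset.card_le_card h2
      rw [Finset.card_union_of_disjoint hd] at h3
      have h4 := Finset.card_le_card h1
      omega
    · rintro rfl
      have h1 : M.filter (· ∉ att.malicious) ⊆
          M.filter fun p => e p = some (commonValue G f x att k h) := fun p hp => by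
        rw [Finset.mem_filter] at hp ⊢
        exact ⟨hp.1, hval p hp.1 hp.2⟩
      have h2 : (M.filter fun p => (e p).isSome) ⊆
          (M.filter fun p => e p = some (commonValue G f x att k h)) ∪
            M.filter (· ∈ att.malicious) := fun p hp => by
        rw [Finset.mem_filter] at hp
        rw [Finset.mem_union, Finset.mem_filter, Finset.mem_filter]
        by_cases hpA : p ∈ att.malicious
        · exact Or.inr ⟨hp.1, hpA⟩
        · exact Or.inl ⟨hp.1, hval p hp.1 hpA⟩
      have h3 := (Finset.card_le_card h2).trans (Finset.card_union_le _ _)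
      have h4 := Finset.card_le_card h1
      omega

/-- The mass of `j` only depends on the records of the closed neighborhood of `j`. -/
lemma newMass_congr {δ₁ δ₁' δ₂ δ₂' : V → ℝ × ℝ} (a a' : Finset V) (l : ℝ × ℝ)
    (h₁ : ∀ h ∈ insert j (nbrs G j), δ₁ h = δ₂ h) (h₂ : ∀ h ∈ insert j (nbrs G j), δ₁' h = δ₂' h) :
    newMass G j δ₁ δ₁' a a' l = newMass G j δ₂ δ₂' a a' l := by
  unfold newMass
  congr 1
  exact Finset.sum_congr rfl fun h hh => by rw [h₁ h hh, h₂ h hh]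

lemma entryValue_infoSet (s : AvgState V) {h : V} (hh : h ∈ insert j (nbrs G j)) :
    entryValue (infoSet G j s) h = s.delta h := by
  simp only [entryValue, infoSet, hh, if_true, Option.getD_some]

/-- Reconstructing the running sums from two successive prescribed information sets is one step of
the averaging. -/
lemma reconstruct_infoSet (s : AvgState V) (a' : Finset V) (recv : V → ℝ × ℝ) :
    reconstruct G j (infoSet G j s) (infoSet G j (avgStep G j s a' recv))
      = (avgStep G j s a' recv).next := by
  have hj : entryValue (infoSet G j (avgStep G j s a' recv)) j = s.next := by
    rw [entryValue_infoSet _ (Finset.mem_insert_self _ _)]; simp [avgStep]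
  unfold reconstruct
  rw [hj, newMass_congr (δ₂ := s.delta) (δ₂' := (avgStep G j s a' recv).delta) _ _ _
    (fun h hh => entryValue_infoSet _ hh) (fun h hh => entryValue_infoSet _ hh)]
  rfl

/-- The tests characterize the prescribed information set of a neighbor that has not misbehaved
before. -/
lemma Synchronized.passes_iff (hs : Synchronized G f x att k)
    (hA : IsLocal G f att.malicious) (hG : TwoHopDetectable G f) (hi : i ∉ att.malicious)
    (hji : G.Adj j i) (hj : j ∉ misbehaved G f x att k) {known : Finset V}
    (hK : nbrs G j ∩ known = nbrs G j ∩ misbehaved G f x att k) (m : InfoSet V) :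
    Passes G i (state G f x att k i) (sent G f x att k) known j m
      ↔ m = infoSet G j (prescribed G f x att k j) := by
  have hrec : ∀ m : InfoSet V, m.accused = (prescribed G f x att k j).accused →
      (∀ h ∈ insert j (nbrs G j), entryValue m h = (prescribed G f x att k j).delta h) →
      reconstruct G j ((state G f x att k i).heard j) m = (prescribed G f x att k j).next := by
    intro m hma hme
    have h1 := reconstruct_infoSet (G := G) (j := j) (prescribedBefore G f x att k j)
      (nbrs G j ∩ misbehaved G f x att k) (received G f x att k)
    rw [← prescribed_eq] at h1
    rw [hs.heard_eq i hi j hj, ← h1]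
    unfold reconstruct
    rw [hma, hme j (Finset.mem_insert_self _ _),
      entryValue_infoSet _ (Finset.mem_insert_self _ _),
      newMass_congr (δ₂ := entryValue (infoSet G j (prescribedBefore G f x att k j)))
        (δ₂' := entryValue (infoSet G j (prescribed G f x att k j))) _ _ _ (fun _ _ => rfl)
        (fun h hh => by rw [hme h hh, entryValue_infoSet _ hh])]
    rfl
  constructor
  · rintro ⟨t1, ⟨t2, t3, t4⟩, t5, t6⟩
    have hacc : m.accused = (prescribed G f x att k j).accused := by
      rw [prescribed_accused, ← hK, ← t1, Finset.inter_eq_right.2 t3]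
    have hent : ∀ h ∈ insert j (nbrs G j),
        m.entries h = some ((prescribed G f x att k j).delta h) := fun h hh => by
      rw [prescribed_delta hs.received_eq hj hh]
      exact t5 h hh _ ((hs.checkValue_iff hA hG hi hji hh _).2 rfl)
    refine InfoSet.ext t2 hacc ?_ ?_
    · rw [t6]
      exact hrec m hacc fun h hh => by simp [entryValue, hent h hh]
    · funext h
      by_cases hh : h ∈ insert j (nbrs G j)
      · simp only [infoSet, hh, if_true, hent h hh]
      · simp only [infoSet, hh, if_false]
        have := mt (t4 h).1 hh
        simpa using this
  · rintro rfl
    refine ⟨?_, ⟨rfl, ?_, ?_⟩, ?_, ?_⟩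
    · rw [hK, infoSet, prescribed_accused, ← Finset.inter_assoc, Finset.inter_self]
    · rw [infoSet, prescribed_accused]; exact Finset.inter_subset_left
    · intro h
      by_cases hh : h ∈ insert j (nbrs G j) <;> simp only [infoSet, hh, if_true, if_false] <;> simp
    · intro h hh v hv
      rw [hs.checkValue_iff hA hG hi hji hh] at hv
      simp only [infoSet, hh, if_true, hv, prescribed_delta hs.received_eq hj hh]
    · exact (hrec _ rfl fun h hh => entryValue_infoSet _ hh).symm

lemma Synchronized.newAccused_eq (hs : Synchronized G f x att k)
    (hA : IsLocal G f att.malicious) (hG : TwoHopDetectable G f) (hi : i ∉ att.malicious) :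
    newAccused G f i (state G f x att k i) (sent G f x att k)
      = nbrs G i ∩ misbehaved G f x att (k + 1) := by
  ext j
  simp only [newAccused, Finset.mem_union, Finset.mem_filter, hs.votedAccused_eq hA hi]
  by_cases hji : j ∈ nbrs G i
  · by_cases hj : j ∈ misbehaved G f x att k
    · have := misbehaved_monotone (Nat.le_succ k) hj
      simp only [Finset.mem_inter, hji, hj, this, true_and, true_or]
    · have hp := fun m => hs.passes_iff hA hG hi (mem_nbrs.1 hji) hj
        (hs.nbrs_inter_known hA hG hi (mem_nbrs.1 hji)) m
      rw [hs.votedAccused_eq hA hi] at hp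
      simp only [hp, Finset.mem_inter, hji, hj, true_and, false_or, exists_eq_right]
      rw [not_iff_comm]
      constructor
      · intro h; exact hs.sent_of_not_mem h
      · intro h
        rw [misbehaved_succ, Finset.mem_union, Finset.mem_filter]
        simp [hj, h]
  · simp only [Finset.mem_inter, hji, false_and, or_self]

lemma Synchronized.succ (hs : Synchronized G f x att k)
    (hA : IsLocal G f att.malicious) (hG : TwoHopDetectable G f) :
    Synchronized G f x att (k + 1) where
  state_eq := fun i hi => by
    change avgStep G i (state G f x att k i).toAvgState
      (newAccused G f i (state G f x att k i) (sent G f x att k)) _ = _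
    rw [hs.newAccused_eq hA hG hi, hs.state_eq i hi, prescribed_eq (k + 1)]
    rfl
  received_eq := fun j hj => by
    simp only [received, hs.sent_of_not_mem hj, Option.map_some, Option.getD_some]
    rfl
  heard_eq := fun i hi j hj => by
    change (sent G f x att k j).getD _ = _
    rw [hs.sent_of_not_mem hj]
    rfl
  accused2_subset := fun i hi =>
    (hs.newAccused2_subset hA hi).trans (misbehaved_monotone (Nat.le_succ k))

end Step

lemma synchronized (hA : IsLocal G f att.malicious) (hG : TwoHopDetectable G f) (k : ℕ) :
    Synchronized G f x att k := by
  induction k with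
  | zero => exact synchronized_zero
  | succ k ih => exact ih.succ hA hG

theorem detectsWithinTwoHops_of_twoHopDetectable (hG : TwoHopDetectable G f) :
    DetectsWithinTwoHops G f := by
  intro x att hA i hi k j hj
  have hs : Synchronized G f x att k := synchronized hA hG k
  refine ⟨fun hji => ?_, fun ht => ?_⟩
  · rw [hs.accused_eq hi]
    exact Finset.mem_inter.2 ⟨mem_nbrs.2 hji, hj⟩
  · by_cases hji : G.Adj j i
    · left
      rw [(hs.succ hA hG).accused_eq hi]
      exact Finset.mem_inter.2 ⟨mem_nbrs.2 hji, misbehaved_monotone (Nat.le_succ k) hj⟩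
    · right
      refine Finset.mem_union_right _ (Finset.mem_filter.2 ⟨Finset.mem_univ _, ?_,
        hs.voted_of_twoHop hA hG hi hj ht hji⟩)
      rwa [mem_nbrs]

/-! ### An undetected attack on graphs that are not detectable -/

/-- The variables of node `j` at time `1` when all nodes start properly from the value `0`. -/
def honestState (G : SimpleGraph V) (j : V) : AvgState V :=
  avgStep G j (initAvg G 0 j) ∅ fun p => (initAvg G 0 p).next

/-- The information set of `j` in which the entry for `h` is shifted, with the running sums adapted
to the false entry. -/
def forgedInfo (G : SimpleGraph V) (h j : V) : InfoSet V :=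
  let m : InfoSet V :=
    { infoSet G j (honestState G j) with
      entries := fun p => if p = h then some ((honestState G j).delta h + (1, 0))
        else (infoSet G j (honestState G j)).entries p }
  { m with next := reconstruct G j (infoSet G j (initAvg G 0 j)) m }

/-- The nodes of `S` start properly and then give a false record of `h`. -/
def forgery (G : SimpleGraph V) (h : V) (S : Finset V) : Attack V where
  malicious := S
  initialZ := fun _ => some 1
  info := fun _ j => some (forgedInfo G h j)

section Forgery

variable {h : V} {S : Finset V}

lemma firstMsg_forgery (j : V) :
    firstMsg G 0 (forgery G h S) j = some (initAvg G 0 j).next := by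
  unfold firstMsg
  split_ifs <;> rfl

lemma misbehaved_forgery_zero : misbehaved G f 0 (forgery G h S) 0 = ∅ := by
  rw [misbehaved_zero, Finset.filter_eq_empty_iff]
  intro j _
  rw [not_not]
  exact ⟨_, firstMsg_forgery j, by simp [initAvg]⟩

lemma prescribed_forgery_zero (j : V) :
    prescribed G f 0 (forgery G h S) 0 j = honestState G j := by
  rw [prescribed_eq, misbehaved_forgery_zero, Finset.inter_empty, honestState]
  congr 1
  funext p
  simp [received, firstMsg_forgery]

lemma sent_forgery_of_mem {j : V} (hj : j ∈ S) :
    sent G f 0 (forgery G h S) 0 j = some (forgedInfo G h j) := by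
  simp [sent, broadcast, forgery, hj]

lemma honestState_delta {j p : V} (hp : p ∈ insert j (nbrs G j)) :
    (honestState G j).delta p = (initAvg G 0 p).next := by
  rcases eq_or_ne p j with rfl | hne
  · simp [honestState, avgStep]
  · have := (Finset.mem_insert.1 hp).resolve_left hne
    simp only [honestState, avgStep, hne, if_false, Finset.sdiff_empty, this, if_true]

lemma forgedInfo_entries {j p : V} (hp : p ∈ insert j (nbrs G j)) :
    (forgedInfo G h j).entries p =
      some (if p = h then (initAvg G 0 p).next + (1, 0) else (initAvg G 0 p).next) := by
  by_cases hph : p = h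
  · subst hph; simp [forgedInfo, honestState_delta hp]
  · simp only [forgedInfo, hph, if_false, infoSet, hp, if_true, honestState_delta hp]

lemma sent_forgery_entries {j p : V} (hp : p ∈ insert j (nbrs G j)) :
    (sent G f 0 (forgery G h S) 0 j).bind (fun m => m.entries p) =
      some (if j ∈ S ∧ p = h then (initAvg G 0 p).next + (1, 0) else (initAvg G 0 p).next) := by
  by_cases hj : j ∈ S
  · rw [sent_forgery_of_mem hj, Option.bind_some, forgedInfo_entries hp]
    simp [hj]
  · rw [synchronized_zero.sent_of_normal (by exact hj), Option.bind_some, prescribed_forgery_zero]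
    simp only [infoSet, hp, if_true, honestState_delta hp, hj, false_and, if_false]

/-- If at least half of the common neighbors of `h` and `i` join the forgery, then the honest record of
`h` has no majority and each of them passes the tests of `i`. -/
lemma passes_forgery {i j : V} (hhi : h ≠ i) (hna : ¬ G.Adj h i) (hS : S ⊆ middleNodes G h i)
    (hcard : (middleNodes G h i).card ≤ 2 * S.card) (hj : j ∈ S) :
    Passes G i (state G f 0 (forgery G h S) 0 i) (sent G f 0 (forgery G h S) 0) ∅ j
      (forgedInfo G h j) := by
  obtain ⟨hhj, hji⟩ := mem_middleNodes.1 (hS hj)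
  refine ⟨rfl, ⟨rfl, Finset.empty_subset _, ?_⟩, ?_, rfl⟩
  · intro p
    by_cases hp : p ∈ insert j (nbrs G j)
    · simp only [forgedInfo_entries hp, hp, Option.isSome_some]
    · have hph : p ≠ h := by
        rintro rfl
        exact hp (Finset.mem_insert_of_mem (mem_nbrs.2 hhj))
      simp only [forgedInfo, infoSet, hph, hp, if_false]
      simp
  · intro p hp v hv
    rw [forgedInfo_entries hp, Option.some_inj]
    unfold CheckValue at hv
    split_ifs at hv with hpi
    · have hph : p ≠ h := by
        rintro rfl
        rcases Finset.mem_insert.1 hpi with h1 | h1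
        · exact hhi h1
        · exact hna (mem_nbrs.1 h1)
      rw [if_neg hph, hv, firstState_toAvgState, prescribed_forgery_zero, honestState_delta hpi]
    · set M := middleNodes G p i
      have hval : ∀ q ∈ M, (sent G f 0 (forgery G h S) 0 q).bind (fun m => m.entries p) =
          some (if q ∈ S ∧ p = h then (initAvg G 0 p).next + (1, 0) else (initAvg G 0 p).next) :=
        fun q hq => sent_forgery_entries
          (Finset.mem_insert_of_mem (mem_nbrs.2 (mem_middleNodes.1 hq).1))
      rw [Finset.filter_true_of_mem (fun q hq => by rw [hval q hq, Option.isSome_some])] at hv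
      by_contra hne
      -- the supporters of a value other than that of `j` are outside of `S`
      have hsub : (M.filter fun q =>
          (sent G f 0 (forgery G h S) 0 q).bind (fun m => m.entries p) = some v) ⊆
          if p = h then M \ S else ∅ := by
        intro q hq
        obtain ⟨hqM, hq⟩ := Finset.mem_filter.1 hq
        rw [hval q hqM, Option.some_inj] at hq
        by_cases hph : p = h
        · rw [if_pos hph, Finset.mem_sdiff]
          refine ⟨hqM, fun hqS => hne ?_⟩
          rw [← hq, if_pos hph, if_pos ⟨hqS, hph⟩]
        · rw [if_neg (fun h' => hph h'.2)] at hq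
          rw [if_neg hph] at hne
          exact absurd hq hne
      have hle := Finset.card_le_card hsub
      split_ifs at hle with hph
      · subst hph
        have h1 : (M \ S).card + S.card = M.card := Finset.card_sdiff_add_card_eq_card hS
        change M.card ≤ _ at hcard
        omega
      · rw [Finset.card_empty] at hle
        omega

end Forgery

theorem twoHopDetectable_of_detectsWithinTwoHops (hD : DetectsWithinTwoHops G f) :
    TwoHopDetectable G f := by
  intro i h ⟨hhi, p, hp⟩
  by_contra hnd
  simp only [Detectable, not_or, not_and, not_le] at hnd
  obtain ⟨hna, hlt⟩ := hnd
  replace hlt := hlt hhi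
  have hpos : 0 < (middleNodes G h i).card := Finset.card_pos.2 ⟨p, mem_middleNodes.2 hp⟩
  -- half of the at most `2 f` common neighbors, rounded up, are malicious
  obtain ⟨S, hS, hcard⟩ := Finset.exists_subset_card_eq
    (s := middleNodes G h i) (n := ((middleNodes G h i).card + 1) / 2) (by omega)
  obtain ⟨j, hj⟩ : S.Nonempty := Finset.card_pos.1 (by omega)
  obtain ⟨hhj, hji⟩ := mem_middleNodes.1 (hS hj)
  have hA : IsLocal G f (forgery G h S).malicious := fun q _ =>
    (Finset.card_le_card (Finset.inter_subset_right (s₂ := S))).trans (by omega)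
  have hiS : i ∉ (forgery G h S).malicious := fun hi =>
    G.loopless.irrefl i (mem_middleNodes.1 (hS hi)).2
  have hmis : j ∈ misbehaved G f 0 (forgery G h S) 1 := by
    rw [misbehaved_succ, Finset.mem_union, Finset.mem_filter]
    refine Or.inr ⟨hj, fun heq => ?_⟩
    rw [sent_forgery_of_mem hj, Option.some_inj, prescribed_forgery_zero] at heq
    have hmem : h ∈ insert j (nbrs G j) := Finset.mem_insert_of_mem (mem_nbrs.2 hhj)
    have h1 := congrArg (fun m => m.entries h) heq
    simp only [forgedInfo_entries hmem, infoSet, hmem, if_true, honestState_delta hmem,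
      Option.some_inj] at h1
    have h2 := congrArg Prod.fst h1
    simp at h2
  have hdet := (hD 0 (forgery G h S) hA i hiS 1 j hmis).1 hji
  have hs : Synchronized G f 0 (forgery G h S) 0 := synchronized_zero
  have hv := hs.votedAccused_eq hA hiS
  have hk := hs.newAccused2_subset hA hiS
  rw [misbehaved_forgery_zero, Finset.inter_empty] at hv
  rw [misbehaved_forgery_zero, Finset.subset_empty] at hk
  change j ∈ newAccused G f i (state G f 0 (forgery G h S) 0 i) (sent G f 0 (forgery G h S) 0)
    at hdet
  simp only [newAccused, hv, hk, Finset.empty_union, Finset.mem_filter] at hdet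
  exact hdet.2 ⟨_, sent_forgery_of_mem hj, passes_forgery hhi hna hS (by omega) hj⟩

/-! ### Convergence of averaging with running sums -/

section Averaging

variable {W : Type*} {P : Finset W} {N : W → Finset W}

lemma sum_sum_closedNbrs_comm (hsub : ∀ i ∈ P, N i ⊆ P)
    (hsymm : ∀ i ∈ P, ∀ j ∈ P, j ∈ N i → i ∈ N j) (g : W → W → ℝ) :
    ∑ i ∈ P, ∑ j ∈ N i, g i j = ∑ j ∈ P, ∑ i ∈ N j, g i j :=
  Finset.sum_comm' fun i j =>
    ⟨fun ⟨hi, hj⟩ => ⟨hsymm i hi j (hsub i hi hj) hj, hsub i hi hj⟩,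
      fun ⟨hi, hj⟩ => ⟨hsub j hj hi, hsymm j hj i (hsub j hj hi) hi⟩⟩

/-- The energy `∑ d_i u_i²` of the local averaging `u ↦ u'` decreases by the sum of the squared
deviations. -/
lemma energy_decay (hsub : ∀ i ∈ P, N i ⊆ P) (hsymm : ∀ i ∈ P, ∀ j ∈ P, j ∈ N i → i ∈ N j)
    {u u' : W → ℝ} (h : ∀ i ∈ P, ((N i).card : ℝ) * u' i = ∑ j ∈ N i, u j) :
    ∑ i ∈ P, ((N i).card : ℝ) * u' i ^ 2 + ∑ i ∈ P, ∑ j ∈ N i, (u j - u' i) ^ 2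
      = ∑ i ∈ P, ((N i).card : ℝ) * u i ^ 2 := by
  have h1 : ∑ j ∈ P, ((N j).card : ℝ) * u j ^ 2 = ∑ i ∈ P, ∑ j ∈ N i, u j ^ 2 := by
    rw [sum_sum_closedNbrs_comm hsub hsymm]
    simp
  rw [h1, ← Finset.sum_add_distrib]
  refine Finset.sum_congr rfl fun i hi => ?_
  have h2 : ∑ j ∈ N i, (u j - u' i) ^ 2
      = ∑ j ∈ N i, u j ^ 2 - 2 * u' i * ∑ j ∈ N i, u j + ((N i).card : ℝ) * u' i ^ 2 := by
    rw [Finset.mul_sum, ← Finset.sum_sub_distrib, ← nsmul_eq_mul, ← Finset.sum_const,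
      ← Finset.sum_add_distrib]
    exact Finset.sum_congr rfl fun j _ => by ring
  rw [h2, ← h i hi]
  ring

/-- Local averaging over the closed neighborhoods of a graph: the energy converges, so its decrements,
the squared deviations, tend to `0`. -/
lemma tendsto_deviation_of_averaging (hsub : ∀ i ∈ P, N i ⊆ P)
    (hsymm : ∀ i ∈ P, ∀ j ∈ P, j ∈ N i → i ∈ N j) {u : ℕ → W → ℝ}
    (h : ∀ k, ∀ i ∈ P, ((N i).card : ℝ) * u (k + 1) i = ∑ j ∈ N i, u k j) {a b : W}
    (ha : a ∈ P) (hb : b ∈ N a) :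
    Tendsto (fun k => u k b - u (k + 1) a) atTop (𝓝 0) := by
  obtain ⟨E, hE⟩ : ∃ E : ℕ → ℝ, ∀ k, E k = ∑ i ∈ P, ((N i).card : ℝ) * u k i ^ 2 :=
    ⟨_, fun _ => rfl⟩
  have hdec : ∀ k, E (k + 1) + ∑ i ∈ P, ∑ j ∈ N i, (u k j - u (k + 1) i) ^ 2 = E k := fun k => by
    rw [hE, hE]
    exact energy_decay hsub hsymm (h k)
  have hanti : Antitone E := antitone_nat_of_succ_le fun k => by
    have : 0 ≤ ∑ i ∈ P, ∑ j ∈ N i, (u k j - u (k + 1) i) ^ 2 :=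
      Finset.sum_nonneg fun i _ => Finset.sum_nonneg fun j _ => sq_nonneg _
    linarith [hdec k]
  have hbdd : BddBelow (Set.range E) := ⟨0, by
    rintro _ ⟨k, rfl⟩
    rw [hE]
    exact Finset.sum_nonneg fun i _ => mul_nonneg (Nat.cast_nonneg _) (sq_nonneg _)⟩
  have hlim := tendsto_atTop_ciInf hanti hbdd
  have hD : Tendsto (fun k => E k - E (k + 1)) atTop (𝓝 0) := by
    have := hlim.sub (hlim.comp (tendsto_add_atTop_nat 1))
    rwa [sub_self] at this
  have hsq : Tendsto (fun k => (u k b - u (k + 1) a) ^ 2) atTop (𝓝 0) := by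
    refine squeeze_zero (fun k => sq_nonneg _) (fun k => ?_) hD
    rw [← hdec k, add_sub_cancel_left]
    refine (Finset.single_le_sum (f := fun j => (u k j - u (k + 1) a) ^ 2)
      (fun j _ => sq_nonneg _) hb).trans ?_
    exact Finset.single_le_sum (f := fun i => ∑ j ∈ N i, (u k j - u (k + 1) i) ^ 2)
      (fun i _ => Finset.sum_nonneg fun j _ => sq_nonneg _) ha
  have := hsq.sqrt
  simp only [Real.sqrt_sq_eq_abs, Real.sqrt_zero] at this
  exact (tendsto_zero_iff_abs_tendsto_zero _).2 this

lemma tendsto_sub_of_averaging (hself : ∀ i ∈ P, i ∈ N i) (hsub : ∀ i ∈ P, N i ⊆ P)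
    (hsymm : ∀ i ∈ P, ∀ j ∈ P, j ∈ N i → i ∈ N j) {u : ℕ → W → ℝ}
    (h : ∀ k, ∀ i ∈ P, ((N i).card : ℝ) * u (k + 1) i = ∑ j ∈ N i, u k j) {i j : W}
    (hij : Relation.ReflTransGen (fun a b => a ∈ P ∧ b ∈ N a) i j) :
    Tendsto (fun k => u k j - u k i) atTop (𝓝 0) := by
  induction hij with
  | refl => simp
  | tail _ hab ih =>
    obtain ⟨ha, hb⟩ := hab
    have := ((tendsto_deviation_of_averaging hsub hsymm h ha hb).sub
      (tendsto_deviation_of_averaging hsub hsymm h ha (hself _ ha))).add ih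
    simpa using this

/-- The running sums `l` of a ratio consensus on a connected graph with closed neighborhoods `N`: the
increments agree in the limit, and their weighted sum is conserved. -/
lemma tendsto_increment_of_runningSum (hself : ∀ i ∈ P, i ∈ N i) (hsub : ∀ i ∈ P, N i ⊆ P)
    (hsymm : ∀ i ∈ P, ∀ j ∈ P, j ∈ N i → i ∈ N j) {l : ℕ → W → ℝ} {X : W → ℝ}
    (h : ∀ k, ∀ i ∈ P, ((N i).card : ℝ) * l (k + 1) i = X i + ∑ j ∈ N i, l k j) {i : W}
    (hi : i ∈ P) (hconn : ∀ j ∈ P, Relation.ReflTransGen (fun a b => a ∈ P ∧ b ∈ N a) i j) :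
    Tendsto (fun k => l (k + 1) i - l k i) atTop
      (𝓝 ((∑ j ∈ P, X j) / ∑ j ∈ P, ((N j).card : ℝ))) := by
  set u : ℕ → W → ℝ := fun k j => l (k + 1) j - l k j with hu
  have hav : ∀ k, ∀ i ∈ P, ((N i).card : ℝ) * u (k + 1) i = ∑ j ∈ N i, u k j := by
    intro k i hi
    simp only [hu, mul_sub, h _ i hi, Finset.sum_sub_distrib]
    ring
  have hcons : ∀ k, ∑ j ∈ P, ((N j).card : ℝ) * u k j = ∑ j ∈ P, X j := by
    intro k
    have h1 : ∑ j ∈ P, ∑ i ∈ N j, l k i = ∑ j ∈ P, ((N j).card : ℝ) * l k j := by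
      rw [sum_sum_closedNbrs_comm hsub hsymm]
      simp
    calc ∑ j ∈ P, ((N j).card : ℝ) * u k j
        = ∑ j ∈ P, (X j + ∑ i ∈ N j, l k i - ((N j).card : ℝ) * l k j) :=
          Finset.sum_congr rfl fun j hj => by simp only [hu, mul_sub, h k j hj]
      _ = ∑ j ∈ P, X j := by
          rw [Finset.sum_sub_distrib, Finset.sum_add_distrib, h1, add_sub_cancel_right]
  have hpos : 0 < ∑ j ∈ P, ((N j).card : ℝ) :=
    Finset.sum_pos (fun j hj => by exact_mod_cast Finset.card_pos.2 ⟨j, hself j hj⟩) ⟨i, hi⟩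
  have hlim : Tendsto (fun k => ∑ j ∈ P, ((N j).card : ℝ) * (u k j - u k i)) atTop (𝓝 0) := by
    have := tendsto_finsetSum P fun j hj =>
      (tendsto_sub_of_averaging hself hsub hsymm hav (hconn j hj)).const_mul ((N j).card : ℝ)
    simpa using this
  have hform : ∀ k, u k i = (∑ j ∈ P, X j - ∑ j ∈ P, ((N j).card : ℝ) * (u k j - u k i)) /
      ∑ j ∈ P, ((N j).card : ℝ) := by
    intro k
    rw [eq_div_iff hpos.ne']
    simp only [mul_sub, Finset.sum_sub_distrib, hcons, ← Finset.sum_mul]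
    ring
  refine Tendsto.congr (fun k => (hform k).symm) ?_
  simpa using (tendsto_const_nhds.sub hlim).div_const (∑ j ∈ P, ((N j).card : ℝ))

end Averaging

/-! ### Connectedness of the normal nodes -/

/-- On a connected detectable graph, every node is, or is adjacent to, a normal node that can be
reached from the normal node `i` through normal nodes. -/
lemma exists_normal_reachable (hA : IsLocal G f att.malicious) (hG : TwoHopDetectable G f)
    (hconn : G.Connected) {i : V} (hi : i ∉ att.malicious) (v : V) :
    ∃ n ∉ att.malicious, Relation.ReflTransGen
      (fun a b => a ∉ att.malicious ∧ b ∉ att.malicious ∧ G.Adj a b) i n ∧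
        (v = n ∨ G.Adj v n) := by
  obtain ⟨w⟩ := hconn.preconnected v i
  induction w with
  | nil => exact ⟨_, hi, .refl, Or.inl rfl⟩
  | @cons w v _ hwv _ ih =>
    obtain ⟨n, hn, hr, rfl | hvn⟩ := ih hi
    · exact ⟨_, hn, hr, Or.inr hwv⟩
    · by_cases hwn : w = n ∨ G.Adj w n
      · exact ⟨n, hn, hr, hwn⟩
      · rw [not_or] at hwn
        -- `v` is replaced by a normal common neighbor of `w` and `n`
        have hc := lt_card_middleNodes_normal hA hn (hG.le_card ⟨hwn.1, v, hwv, hvn⟩ hwn.2)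
        obtain ⟨p, hp⟩ := Finset.card_pos.1 ((Nat.succ_pos f).trans_le hc)
        rw [Finset.mem_filter, mem_middleNodes] at hp
        exact ⟨p, hp.2, hr.tail ⟨hn, hp.2, hp.1.2.symm⟩, Or.inr hp.1.1⟩

/-! ### Resilient average consensus -/

/-- The averaging steps preserve the relation between the running sum of a node, its initial value
`X` and its records: the compensation for newly detected neighbors makes up for the smaller degree. -/
lemma balance_avgStep {i : V} {s : AvgState V} {a' : Finset V} {recv : V → ℝ × ℝ} {X : ℝ × ℝ}
    (ha : s.accused ⊆ a')
    (h : (1 + ((nbrs G i \ s.accused).card : ℝ)) • s.next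
      = X + ∑ j ∈ insert i (nbrs G i), s.delta j) :
    (1 + ((nbrs G i \ a').card : ℝ)) • (avgStep G i s a' recv).next
      = X + ∑ j ∈ insert i (nbrs G i), (avgStep G i s a' recv).delta j := by
  set t := avgStep G i s a' recv
  have hnext : t.next = s.next + weight G i a' • newMass G i s.delta t.delta s.accused a' s.next :=
    rfl
  have hD : (1 + ((nbrs G i \ a').card : ℝ)) ≠ 0 := by positivity
  have hcard : (((nbrs G i \ s.accused) \ (nbrs G i \ a')).card : ℝ) + ((nbrs G i \ a').card : ℝ)
      = ((nbrs G i \ s.accused).card : ℝ) := by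
    exact_mod_cast Finset.card_sdiff_add_card_eq_card (Finset.sdiff_subset_sdiff le_rfl ha)
  rw [hnext, smul_add, smul_smul, weight, mul_one_div_cancel hD, one_smul, newMass,
    Finset.sum_sub_distrib]
  rw [← hcard] at h
  have hX : X = (1 + ((((nbrs G i \ s.accused) \ (nbrs G i \ a')).card : ℝ) +
      ((nbrs G i \ a').card : ℝ))) • s.next - ∑ j ∈ insert i (nbrs G i), s.delta j := by
    rw [h, add_sub_cancel_right]
  rw [hX]
  module

lemma prescribedBefore_accused_subset (k : ℕ) (i : V) :
    (prescribedBefore G f x att k i).accused ⊆ nbrs G i ∩ misbehaved G f x att k := by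
  cases k with
  | zero => exact Finset.empty_subset _
  | succ k =>
    change (prescribed G f x att k i).accused ⊆ _
    rw [prescribed_accused]
    exact Finset.inter_subset_inter_left (misbehaved_monotone (Nat.le_succ k))

lemma balance_prescribedBefore (k : ℕ) (i : V) :
    (1 + ((nbrs G i \ (prescribedBefore G f x att k i).accused).card : ℝ)) •
      (prescribedBefore G f x att k i).next
      = (x i, 1) + ∑ j ∈ insert i (nbrs G i), (prescribedBefore G f x att k i).delta j := by
  induction k with
  | zero =>
    have hD : (1 + ((nbrs G i).card : ℝ)) ≠ 0 := by positivity
    simp only [prescribedBefore, initAvg, Finset.sdiff_empty, Finset.sum_const_zero, add_zero,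
      weight, smul_smul, mul_one_div_cancel hD, one_smul]
  | succ k ih =>
    change (1 + ((nbrs G i \ (prescribed G f x att k i).accused).card : ℝ)) •
      (prescribed G f x att k i).next = _ + ∑ j ∈ _, (prescribed G f x att k i).delta j
    rw [prescribed_eq]
    exact balance_avgStep (prescribedBefore_accused_subset k i) ih

lemma sdiff_nbrs_inter (i : V) (F : Finset V) : nbrs G i \ (nbrs G i ∩ F) = nbrs G i \ F := by
  simp

/-- The affine iteration of the running sums among the nodes that have not misbehaved. -/
lemma Synchronized.runningSum_succ {k : ℕ} (hs : Synchronized G f x att k) {i : V}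
    (hi : i ∉ misbehaved G f x att k) :
    ((insert i (nbrs G i \ misbehaved G f x att k)).card : ℝ) •
      (prescribedBefore G f x att (k + 1) i).next
      = (x i, 1) + ∑ j ∈ insert i (nbrs G i \ misbehaved G f x att k),
          (prescribedBefore G f x att k j).next := by
  have hb := balance_prescribedBefore (G := G) (f := f) (x := x) (att := att) (k + 1) i
  change (1 + ((nbrs G i \ (prescribed G f x att k i).accused).card : ℝ)) • _
    = _ + ∑ j ∈ _, (prescribed G f x att k i).delta j at hb
  rw [prescribed_accused, sdiff_nbrs_inter] at hb
  rw [Finset.card_insert_of_notMem (by simp), Nat.cast_add, Nat.cast_one, add_comm _ (1 : ℝ), hb]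
  congr 1
  refine (Finset.sum_subset_zero_on_sdiff (Finset.insert_subset_insert _ Finset.sdiff_subset)
    ?_ ?_).symm
  · intro j hj
    obtain ⟨hj1, hj2⟩ := Finset.mem_sdiff.1 hj
    rw [prescribed_delta hs.received_eq hi hj1, commonValue, if_pos]
    by_contra hjm
    refine hj2 (Finset.mem_insert.2 ((Finset.mem_insert.1 hj1).imp_right fun h => ?_))
    exact Finset.mem_sdiff.2 ⟨h, hjm⟩
  · intro j hj
    have hjm : j ∉ misbehaved G f x att k := by
      rcases Finset.mem_insert.1 hj with rfl | hj
      · exact hi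
      · exact (Finset.mem_sdiff.1 hj).2
    rw [prescribed_delta hs.received_eq hi
      (Finset.insert_subset_insert _ Finset.sdiff_subset hj), commonValue, if_neg hjm,
      hs.received_eq j hjm]

lemma prescribed_mass (k : ℕ) (i : V) :
    (prescribed G f x att k i).mass
      = ((insert i (nbrs G i \ misbehaved G f x att k)).card : ℝ) •
        ((prescribedBefore G f x att (k + 1) i).next - (prescribedBefore G f x att k i).next) := by
  have hD : (1 + ((nbrs G i \ misbehaved G f x att k).card : ℝ)) ≠ 0 := by positivity
  have hnext : (prescribedBefore G f x att (k + 1) i).next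
      = (prescribedBefore G f x att k i).next
        + weight G i (nbrs G i ∩ misbehaved G f x att k) • (prescribed G f x att k i).mass := by
    change (prescribed G f x att k i).next = _
    rw [prescribed_eq]; rfl
  rw [hnext, add_sub_cancel_left, weight, sdiff_nbrs_inter, smul_smul,
    Finset.card_insert_of_notMem (by simp), Nat.cast_add, Nat.cast_one, add_comm _ (1 : ℝ),
    mul_one_div_cancel hD, one_smul]

theorem resilientAverageConsensus_of_twoHopDetectable (hG : TwoHopDetectable G f)
    (hconn : G.Connected) : ResilientAverageConsensus G f := by
  intro x att hA i hi
  have hs : ∀ k, Synchronized G f x att k := synchronized hA hG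
  obtain ⟨T, hT⟩ := WellFoundedGT.monotone_chain_condition
    (⟨misbehaved G f x att, misbehaved_monotone⟩ : ℕ →o Finset V)
  change ∀ m, T ≤ m → misbehaved G f x att T = misbehaved G f x att m at hT
  set F := misbehaved G f x att T with hF
  set P := proper G f x att with hP
  have hmemP : ∀ j, j ∈ P ↔ j ∉ F := by
    intro j
    rw [hP, proper, Finset.mem_filter]
    refine ⟨fun h => h.2 T, fun h => ⟨Finset.mem_univ _, fun k hk => h ?_⟩⟩
    rw [hT (max k T) (le_max_right _ _)]
    exact misbehaved_monotone (le_max_left _ _) hk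
  set N : V → Finset V := fun j => insert j (nbrs G j \ F) with hN
  have hself : ∀ j ∈ P, j ∈ N j := fun j _ => Finset.mem_insert_self _ _
  have hsub : ∀ j ∈ P, N j ⊆ P := by
    intro j hj a ha
    rcases Finset.mem_insert.1 ha with rfl | ha
    · exact hj
    · exact (hmemP a).2 (Finset.mem_sdiff.1 ha).2
  have hsymm : ∀ j ∈ P, ∀ a ∈ P, a ∈ N j → j ∈ N a := by
    intro j hj a _ ha
    rcases Finset.mem_insert.1 ha with rfl | ha
    · exact ha
    · refine Finset.mem_insert_of_mem (Finset.mem_sdiff.2 ⟨?_, (hmemP j).1 hj⟩)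
      exact mem_nbrs.2 (mem_nbrs.1 (Finset.mem_sdiff.1 ha).1).symm
  have hnormal : ∀ j, j ∉ att.malicious → j ∈ P := fun j hj =>
    (hmemP j).2 fun h => hj (misbehaved_subset_malicious T h)
  have hreach : ∀ j ∈ P, Relation.ReflTransGen (fun a b => a ∈ P ∧ b ∈ N a) i j := by
    intro j hj
    obtain ⟨n, hn, hr, hjn⟩ := exists_normal_reachable hA hG hconn hi j
    have hr' : Relation.ReflTransGen (fun a b => a ∈ P ∧ b ∈ N a) i n :=
      Relation.ReflTransGen.mono (fun a b ⟨ha, hb, hab⟩ => ⟨hnormal a ha, Finset.mem_insert_of_mem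
        (Finset.mem_sdiff.2 ⟨mem_nbrs.2 hab.symm, (hmemP b).1 (hnormal b hb)⟩)⟩) _ _ hr
    rcases hjn with rfl | hjn
    · exact hr'
    · exact hr'.tail ⟨hnormal n hn, Finset.mem_insert_of_mem
        (Finset.mem_sdiff.2 ⟨mem_nbrs.2 hjn, (hmemP j).1 hj⟩)⟩
  set l : ℕ → V → ℝ × ℝ := fun k j => (prescribedBefore G f x att (k + T) j).next with hl
  have hrec : ∀ k, ∀ j ∈ P, ((N j).card : ℝ) • l (k + 1) j = (x j, 1) + ∑ a ∈ N j, l k a := by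
    intro k j hj
    have hk : misbehaved G f x att (k + T) = F := (hT (k + T) (Nat.le_add_left _ _)).symm
    have := (hs (k + T)).runningSum_succ (i := j) (by rw [hk]; exact (hmemP j).1 hj)
    rw [hk] at this
    simp only [hl, Nat.add_right_comm k 1 T]
    exact this
  have hmass : ∀ k, (state G f x att (k + T) i).mass
      = ((N i).card : ℝ) • (l (k + 1) i - l k i) := by
    intro k
    have hk : misbehaved G f x att (k + T) = F := (hT (k + T) (Nat.le_add_left _ _)).symm
    rw [(hs (k + T)).state_eq i hi, prescribed_mass, hk]
    simp only [hl, hN, Nat.add_right_comm k 1 T]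
  have hiP := hnormal i hi
  have hy := tendsto_increment_of_runningSum hself hsub hsymm
    (l := fun k j => (l k j).1) (X := x) (fun k j hj => by
      have := congrArg Prod.fst (hrec k j hj)
      simpa [Prod.fst_sum] using this) hiP hreach
  have hz := tendsto_increment_of_runningSum hself hsub hsymm
    (l := fun k j => (l k j).2) (X := fun _ => 1) (fun k j hj => by
      have := congrArg Prod.snd (hrec k j hj)
      simpa [Prod.snd_sum] using this) hiP hreach
  have hNpos : (0 : ℝ) < (N i).card := by
    exact_mod_cast Finset.card_pos.2 ⟨i, hself i hiP⟩
  have hPpos : (0 : ℝ) < P.card := by exact_mod_cast Finset.card_pos.2 ⟨i, hiP⟩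
  have hDpos : 0 < ∑ j ∈ P, ((N j).card : ℝ) :=
    Finset.sum_pos (fun j hj => by exact_mod_cast Finset.card_pos.2 ⟨j, hself j hj⟩) ⟨i, hiP⟩
  rw [Finset.sum_const, nsmul_eq_mul, mul_one] at hz
  have hz0 : (P.card : ℝ) / ∑ j ∈ P, ((N j).card : ℝ) ≠ 0 := (div_pos hPpos hDpos).ne'
  constructor
  · have hev : ∀ᶠ k in atTop, (state G f x att (k + T) i).mass.2 ≠ 0 := by
      filter_upwards [hz.eventually_ne hz0] with k hk
      rw [hmass k]
      exact mul_ne_zero hNpos.ne' hk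
    obtain ⟨K, hK⟩ := eventually_atTop.1 hev
    refine eventually_atTop.2 ⟨K + T, fun k hk => ?_⟩
    obtain ⟨m, rfl⟩ := Nat.exists_eq_add_of_le hk
    have := hK (K + m) (Nat.le_add_right _ _)
    rwa [Nat.add_right_comm] at this
  · rw [← tendsto_add_atTop_iff_nat T]
    have hlim := hy.div hz hz0
    rw [div_div_div_cancel_right₀ hDpos.ne'] at hlim
    refine hlim.congr fun k => ?_
    rw [hmass k]
    exact (mul_div_mul_left _ _ hNpos.ne').symm

end ResilientConsensus

end

theorem theorem2 {V : Type*} [Fintype V] (G : SimpleGraph V) (f : ℕ) :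
    (ResilientConsensus.DetectsWithinTwoHops G f ↔ ResilientConsensus.TwoHopDetectable G f) ∧
    (ResilientConsensus.TwoHopDetectable G f → G.Connected →
      ResilientConsensus.ResilientAverageConsensus G f) :=
  ⟨⟨ResilientConsensus.twoHopDetectable_of_detectsWithinTwoHops,
      ResilientConsensus.detectsWithinTwoHops_of_twoHopDetectable⟩,
    ResilientConsensus.resilientAverageConsensus_of_twoHopDetectable⟩
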